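/- Let $\mathbb{Q}^+$ be the set of positive rational numbers. Call a first-order theory $T$ finitely axiomatizable if there is a finite set of sentences in the language of $T$ with exactly the same logical consequences as $T$. **Theorem.** The (complete) first-order theory of $\langle\mathbb{Q}^+;\times\rangle$ is not finitely axiomatizable, and neither is that of $\langle\mathbb{Q}^+;\times,\mathbf{1},{}^{-1}\rangle$. Moreover, let $p$ be any prime, let $\omega_p=\cos(2\pi/p)+i\sin(2\pi/p)$, and let $$G_p=\{\,r\cdot\omega_p^{\,k} : r\in\mathbb{Q}^+,\ k\in\mathbb{N}\,\},$$ a group under multiplication of complex numbers. Then $G_p$ satisfies the following sentences in the language $\{\times,\mathbf 1,{}^{-1}\}$: - $(M_1)$ $\forall x,y,z\,\big(x\cdot(y\cdot z)=(x\cdot y)\cdot z\big)$; - $(M_2)$ $\forall x\,(x\cdot\mathbf 1=x)$; - $(M_3^\circ)$ $\forall x\,(x\cdot x^{-1}=\mathbf 1)$; - $(M_4)$ $\forall x,y\,(x\cdot y=y\cdot x)$; - $(M_{16,n})$ $\forall v_1,\dots,v_\ell\,\exists x\,\forall z\,\bigwedge_{k=1}^{\ell}\big(x^n\cdot v_k\neq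 z^{m_k}\big)$, for all natural numbers $n\ge 1$, $\ell\geq 0$ and $m_1,\dots,m_\ell$ such that no $m_k$ divides $n$. For every natural number $n\ge 1$, the group $G_p$ satisfies the torsion-freeness axiom $$(M_{7,n}^\circ)\quad \forall x\,\big(x^n=\mathbf 1\rightarrow x=\mathbf 1\big)$$ if and only if $p\nmid n$. In particular, $G_p$ satisfies $M_{7,n}^\circ$ for all $1\le n<p$, but not $M_{7,p}^\circ$. -/

import Mathlib

open FirstOrder FirstOrder.Language

namespace PosRatMul

/-- A theory is finitely axiomatizable if some finite set of sentences of the same language has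
exactly the same (semantic) consequences. -/
def FinitelyAxiomatizable {L : FirstOrder.Language.{0, 0}} (T : L.Theory) : Prop :=
  ∃ S : L.Theory, S.Finite ∧ ∀ φ : L.Sentence, S ⊨ᵇ φ ↔ T ⊨ᵇ φ

/-- The function symbols of the language with one binary operation. -/
inductive MulFunc : ℕ → Type
  | mul : MulFunc 2

/-- The language `{×}`. -/
def mulLang : FirstOrder.Language.{0, 0} where
  Functions := MulFunc
  Relations := fun _ => Empty

/-- The function symbols of the language of multiplicative groups. -/
inductive GroupFunc : ℕ → Type
  | mul : GroupFunc 2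
  | one : GroupFunc 0
  | inv : GroupFunc 1

/-- The language `{×, 1, ⁻¹}`. -/
def groupLang : FirstOrder.Language.{0, 0} where
  Functions := GroupFunc
  Relations := fun _ => Empty

/-- `⟨G; ×⟩`. -/
@[reducible] def mulStructure (G : Type*) [Mul G] : mulLang.Structure G where
  funMap := fun {_} f => match f with
    | MulFunc.mul => fun v => v 0 * v 1
  RelMap := fun {_} r => Empty.elim r

/-- `⟨G; ×, 1, ⁻¹⟩`. -/
@[reducible] def groupStructure (G : Type*) [Group G] : groupLang.Structure G where
  funMap := fun {_} f => match f with
    | GroupFunc.mul => fun v => v 0 * v 1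
    | GroupFunc.one => fun _ => 1
    | GroupFunc.inv => fun v => (v 0)⁻¹
  RelMap := fun {_} r => Empty.elim r

/-- The positive rational numbers, with Mathlib's multiplication, unit and inverse. -/
abbrev PosRat : Type := {q : ℚ // 0 < q}

instance : mulLang.Structure PosRat := mulStructure PosRat

instance : groupLang.Structure PosRat := groupStructure PosRat

/-- `ω_n = cos (2π/n) + i sin (2π/n)`. -/
noncomputable def omega (n : ℕ) : ℂ :=
  Complex.cos (2 * Real.pi / n) + Complex.sin (2 * Real.pi / n) * Complex.I

theorem omega_pow_self (n : ℕ) : omega n ^ n = 1 := by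
  rcases Nat.eq_zero_or_pos n with rfl | hn
  · simp
  · have hn' : (n : ℂ) ≠ 0 := by exact_mod_cast hn.ne'
    rw [omega, ← Complex.exp_mul_I, ← Complex.exp_nat_mul,
      show (n : ℂ) * (2 * Real.pi / n * Complex.I) = 2 * Real.pi * Complex.I by field_simp,
      Complex.exp_two_pi_mul_I]

theorem omega_zero : omega 0 = 1 := by simp [omega]

/-- The multiplicative group `{r · ω_p ^ k : r ∈ ℚ⁺, k ∈ ℕ}` of nonzero complex numbers. -/
noncomputable def twistedGroup (p : ℕ) : Subgroup ℂˣ where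
  carrier := {z | ∃ (r : ℚ) (k : ℕ), 0 < r ∧ (z : ℂ) = (r : ℂ) * omega p ^ k}
  mul_mem' := by
    rintro a b ⟨r, k, hr, ha⟩ ⟨s, l, hs, hb⟩
    refine ⟨r * s, k + l, mul_pos hr hs, ?_⟩
    rw [Units.val_mul, ha, hb]
    push_cast
    ring
  one_mem' := ⟨1, 0, one_pos, by simp⟩
  inv_mem' := by
    rintro a ⟨r, k, hr, ha⟩
    have hr' : (r : ℂ) ≠ 0 := by exact_mod_cast hr.ne'
    refine ⟨r⁻¹, (p - 1) * k, inv_pos.2 hr, ?_⟩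
    have key : omega p ^ k * omega p ^ ((p - 1) * k) = 1 := by
      rcases Nat.eq_zero_or_pos p with rfl | hp
      · simp [omega_zero]
      · rw [← pow_add, show k + (p - 1) * k = p * k by
          obtain ⟨q, rfl⟩ : ∃ q, p = q + 1 := ⟨p - 1, by omega⟩
          simp only [Nat.add_sub_cancel]
          ring, pow_mul, omega_pow_self, one_pow]
    rw [Units.val_inv_eq_inv_val]
    refine inv_eq_of_mul_eq_one_right ?_
    rw [ha]
    push_cast
    calc (r : ℂ) * omega p ^ k * ((r : ℂ)⁻¹ * omega p ^ ((p - 1) * k))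
        = ((r : ℂ) * (r : ℂ)⁻¹) * (omega p ^ k * omega p ^ ((p - 1) * k)) := by ring
      _ = 1 := by rw [key, mul_inv_cancel₀ hr', one_mul]

noncomputable instance (p : ℕ) : groupLang.Structure (twistedGroup p) :=
  groupStructure (twistedGroup p)

section Axioms

variable {α : Type}

/-- The term `s · t`. -/
def tmul (s t : groupLang.Term α) : groupLang.Term α :=
  Functions.apply₂ (L := groupLang) GroupFunc.mul s t

/-- The constant term `1`. -/
def tone : groupLang.Term α :=
  Constants.term (L := groupLang) GroupFunc.one

/-- The term `t⁻¹`. -/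
def tinv (t : groupLang.Term α) : groupLang.Term α :=
  Functions.apply₁ (L := groupLang) GroupFunc.inv t

/-- The term `t ^ n`. -/
def tpow (t : groupLang.Term α) : ℕ → groupLang.Term α
  | 0 => tone
  | n + 1 => tmul (tpow t n) t

/-- `∀ x y z, x · (y · z) = (x · y) · z`. -/
def axAssoc : groupLang.Sentence :=
  ∀' ∀' ∀' (tmul (&0) (tmul (&1) (&2)) =' tmul (tmul (&0) (&1)) (&2))

/-- `∀ x, x · 1 = x`. -/
def axOne : groupLang.Sentence :=
  ∀' (tmul (&0) tone =' &0)

/-- `∀ x, x · x⁻¹ = 1`. -/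
def axInv : groupLang.Sentence :=
  ∀' (tmul (&0) (tinv (&0)) =' tone)

/-- `∀ x y, x · y = y · x`. -/
def axComm : groupLang.Sentence :=
  ∀' ∀' (tmul (&0) (&1) =' tmul (&1) (&0))

/-- `∀ x, x ^ n = 1 → x = 1`. -/
def axTorsionFree (n : ℕ) : groupLang.Sentence :=
  ∀' ((tpow (&0) n =' tone) ⟹ (&0 =' tone))

/-- `∀ v₁ … v_ℓ, ∃ x, ∀ z, ⋀ k, x ^ n · v_k ≠ z ^ (m k)`; the bound variables are, in this order,
the `v_k`, then `x`, then `z`. -/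
noncomputable def axNonPower (n ℓ : ℕ) (m : Fin ℓ → ℕ) : groupLang.Sentence :=
  BoundedFormula.alls (n := ℓ) (∃' ∀' (BoundedFormula.iInf fun k : Fin ℓ =>
    ∼((tmul (tpow (Term.var (Sum.inr (Fin.last ℓ).castSucc)) n)
          (Term.var (Sum.inr k.castSucc.castSucc))) ='
        (tpow (Term.var (Sum.inr (Fin.last (ℓ + 1)))) (m k)))))

/-- All the axioms for `⟨ℚ⁺; ×, 1, ⁻¹⟩` other than the torsion-freeness ones. -/
def coreAxioms : groupLang.Theory :=
  {axAssoc, axOne, axInv, axComm} ∪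
    {φ | ∃ (n ℓ : ℕ) (m : Fin ℓ → ℕ), 1 ≤ n ∧ (∀ k, ¬ m k ∣ n) ∧ φ = axNonPower n ℓ m}

end Axioms

end PosRatMul

/-! Non-finite axiomatizability comes from the groups `ℚ⁺ × ℤ/(n! + 1)`. Each has torsion, so none
is elementarily equivalent to `ℚ⁺`; yet along a nonprincipal ultrafilter their ultraproduct is
isomorphic to the ultrapower `H` of `ℚ⁺`. By Łoś, any finite set of sentences true in `ℚ⁺` then
holds in some of them.

For the isomorphism, each fixed `k ≠ 0` is a unit modulo `n! + 1` for large `n`, so the ultraproduct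
`V` of the finite factors is a rational vector space. The divisible part `D` of `H` splits off, has
infinite rank, and is at least as large as `V`; hence `D × V ≃ D` and `H × V ≃ H`.

For `G_p`, the norm is a homomorphism to `ℚ⁺` that forgets the roots of unity, so the non-power
axioms follow from a `q`-adic valuation, while torsion comes only from `ω_p`. -/

namespace PosRatMul

/-! ### Torsion-free divisible groups and their absorption -/

section Divisible

variable (H : Type*) [AddCommGroup H]

/-- The subgroup of elements divisible by every nonzero integer. -/
def divisiblePart : AddSubgroup H where
  carrier := {x | ∀ n : ℤ, n ≠ 0 → ∃ y, n • y = x}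
  zero_mem' := fun _ _ => ⟨0, smul_zero _⟩
  add_mem' := by
    intro a b ha hb n hn
    obtain ⟨y, rfl⟩ := ha n hn
    obtain ⟨z, rfl⟩ := hb n hn
    exact ⟨y + z, smul_add _ _ _⟩
  neg_mem' := by
    intro a ha n hn
    obtain ⟨y, rfl⟩ := ha n hn
    exact ⟨-y, smul_neg _ _⟩

variable {H}

/-- Quotients by `n` are unique, so dividing `x` by `n * m` shows that `x / n` is itself divisible
by `m`. -/
theorem exists_zsmul_eq_divisiblePart [IsAddTorsionFree H] (n : ℤ) (hn : n ≠ 0)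
    (x : divisiblePart H) : ∃ y : divisiblePart H, n • y = x := by
  obtain ⟨y, hy⟩ := x.2 n hn
  refine ⟨⟨y, fun m hm => ?_⟩, Subtype.ext hy⟩
  obtain ⟨z, hz⟩ := x.2 (n * m) (mul_ne_zero hn hm)
  exact ⟨z, zsmul_right_injective hn (by simpa [mul_smul, hy] using hz)⟩

theorem isLocalizedModule_id_of_divisible [IsAddTorsionFree H]
    (hdiv : ∀ n : ℤ, n ≠ 0 → ∀ x : H, ∃ y, n • y = x) :
    IsLocalizedModule (nonZeroDivisors ℤ) (LinearMap.id : H →ₗ[ℤ] H) where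
  map_units s := by
    have hs : (s : ℤ) ≠ 0 := nonZeroDivisors.coe_ne_zero s
    rw [Module.End.isUnit_iff]
    exact ⟨fun a b h => zsmul_right_injective hs (by simpa using h), fun x => by
      simpa using hdiv s hs x⟩
  surj y := ⟨(y, 1), by simp⟩
  exists_of_eq h := ⟨1, by simpa using h⟩

/-- A torsion-free divisible abelian group is a rational vector space. -/
theorem nonempty_ratModule_of_divisible [IsAddTorsionFree H]
    (hdiv : ∀ n : ℤ, n ≠ 0 → ∀ x : H, ∃ y, n • y = x) : Nonempty (Module ℚ H) :=
  have := isLocalizedModule_id_of_divisible hdiv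
  ⟨IsLocalizedModule.module (nonZeroDivisors ℤ) (LinearMap.id : H →ₗ[ℤ] H)⟩

/-- A divisible group is injective (Baer), so the inclusion of the divisible part has a retraction,
whose kernel is the complement. -/
theorem exists_addEquiv_prod_divisiblePart [IsAddTorsionFree H] :
    ∃ K : AddSubgroup H, Nonempty (H ≃+ K × divisiblePart H) := by
  let _ : DivisibleBy (divisiblePart H) ℤ :=
    divisibleByOfSMulRightSurj _ _ fun {n} hn x => exists_zsmul_eq_divisiblePart n hn x
  obtain ⟨r, hr⟩ := (Module.Baer.of_divisible (divisiblePart H)).extension_property_addMonoidHom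
    (divisiblePart H).subtype Subtype.val_injective (AddMonoidHom.id _)
  have hr' : ∀ d : divisiblePart H, r d = d := fun d => DFunLike.congr_fun hr d
  refine ⟨r.ker, ⟨⟨⟨fun x => (⟨x - r x, ?_⟩, r x), fun y => y.1 + y.2, ?_, ?_⟩, ?_⟩⟩⟩
  · simp [AddMonoidHom.mem_ker, hr']
  · intro x
    simp
  · rintro ⟨⟨a, ha⟩, d⟩
    rw [AddMonoidHom.mem_ker] at ha
    ext <;> simp [hr', ha]
  · intro x y
    ext
    · simp only [map_add, AddSubgroup.coe_add, Prod.fst_add]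
      abel
    · simp

theorem mk_eq_rank_of_aleph0_le (D : Type) [AddCommGroup D] [Module ℚ D]
    (h : Cardinal.aleph0 ≤ Module.rank ℚ D) : Cardinal.mk D = Module.rank ℚ D := by
  let b := Module.Free.chooseBasis ℚ D
  rw [← b.mk_eq_rank''] at h ⊢
  have := Cardinal.infinite_iff.2 h
  rw [b.repr.toEquiv.cardinal_eq, Cardinal.mk_finsupp_of_infinite, max_eq_left]
  simp

/-- Since `ℚ` is countable, `rank V ≤ #V ≤ #D = rank D`, and an infinite cardinal absorbs a smaller
summand. -/
theorem nonempty_prod_linearEquiv (D V : Type) [AddCommGroup D] [Module ℚ D] [AddCommGroup V]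
    [Module ℚ V] (h : Cardinal.aleph0 ≤ Module.rank ℚ D) (f : V → D) (hf : Function.Injective f) :
    Nonempty ((D × V) ≃ₗ[ℚ] D) := by
  apply nonempty_linearEquiv_of_rank_eq
  rw [rank_prod']
  refine Cardinal.add_eq_left h ((rank_le_card ℚ V).trans ?_)
  rw [← mk_eq_rank_of_aleph0_le D h]
  exact Cardinal.mk_le_of_injective hf

/-- A torsion-free abelian group whose divisible part is large absorbs rational vector spaces. -/
theorem nonempty_prod_addEquiv_of_divisible {H V : Type} [AddCommGroup H] [AddCommGroup V]
    [IsAddTorsionFree H] [IsAddTorsionFree V]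
    (hV : ∀ n : ℤ, n ≠ 0 → ∀ x : V, ∃ y, n • y = x)
    {ι : Type} [Infinite ι] (x : ι → H) (hx : LinearIndependent ℤ x)
    (hxD : ∀ i, x i ∈ divisiblePart H)
    (f : V → H) (hf : Function.Injective f) (hfD : ∀ v, f v ∈ divisiblePart H) :
    Nonempty (H × V ≃+ H) := by
  obtain ⟨K, ⟨e⟩⟩ := exists_addEquiv_prod_divisiblePart (H := H)
  obtain ⟨_⟩ := nonempty_ratModule_of_divisible hV
  obtain ⟨_⟩ := nonempty_ratModule_of_divisible
    (exists_zsmul_eq_divisiblePart (H := H))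
  have hli : LinearIndependent ℚ fun i => (⟨x i, hxD i⟩ : divisiblePart H) := by
    rw [← LinearIndependent.iff_fractionRing ℤ ℚ]
    exact LinearIndependent.of_comp (divisiblePart H).subtype.toIntLinearMap hx
  obtain ⟨g⟩ := nonempty_prod_linearEquiv (divisiblePart H) V
    ((Cardinal.infinite_iff.1 inferInstance).trans hli.cardinal_le_rank)
    (fun v => ⟨f v, hfD v⟩) fun a b h => hf (congrArg Subtype.val h)
  exact ⟨((e.prodCongr (AddEquiv.refl V)).trans AddEquiv.prodAssoc).trans
    (((AddEquiv.refl K).prodCongr g.toAddEquiv).trans e.symm)⟩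

end Divisible

/-! ### Reduced products of `ℚ⁺` and of the cyclic factors -/

section ReducedProduct

open Filter

variable (u : Filter ℕ) (G : ℕ → Type) [∀ n, AddCommGroup (G n)]

/-- The sequences that eventually vanish along `u`. -/
def eventuallyZero : AddSubgroup (∀ n, G n) where
  carrier := {x | ∀ᶠ n in u, x n = 0}
  zero_mem' := Eventually.of_forall fun _ => rfl
  add_mem' := fun ha hb => by
    filter_upwards [ha, hb] with n h₁ h₂
    simp [h₁, h₂]
  neg_mem' := fun ha => by
    filter_upwards [ha] with n h
    simp [h]

/-- The reduced product of a sequence of abelian groups, as a quotient group. -/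
abbrev ReducedProduct : Type := (∀ n, G n) ⧸ eventuallyZero u G

variable {u G}

theorem ReducedProduct.mk_eq_zero {x : ∀ n, G n} :
    (QuotientAddGroup.mk x : ReducedProduct u G) = 0 ↔ ∀ᶠ n in u, x n = 0 :=
  QuotientAddGroup.eq_zero_iff x

theorem ReducedProduct.mk_eq_mk {x y : ∀ n, G n} :
    (QuotientAddGroup.mk x : ReducedProduct u G) = QuotientAddGroup.mk y ↔
      ∀ᶠ n in u, x n = y n := by
  rw [← sub_eq_zero, ← QuotientAddGroup.mk_sub, ReducedProduct.mk_eq_zero]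
  simp [sub_eq_zero]

theorem ReducedProduct.isAddTorsionFree
    (h : ∀ k : ℕ, k ≠ 0 → ∀ᶠ n in u, ∀ x : G n, k • x = 0 → x = 0) :
    IsAddTorsionFree (ReducedProduct u G) where
  nsmul_right_injective k hk := by
    intro a b hab
    obtain ⟨x, rfl⟩ := QuotientAddGroup.mk_surjective a
    obtain ⟨y, rfl⟩ := QuotientAddGroup.mk_surjective b
    simp only [← QuotientAddGroup.mk_nsmul] at hab
    rw [ReducedProduct.mk_eq_mk] at hab ⊢
    filter_upwards [hab, h k hk] with n h₁ h₂
    rw [← sub_eq_zero]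
    exact h₂ _ (by simpa [smul_sub, sub_eq_zero] using h₁)

theorem ReducedProduct.exists_zsmul_eq
    (h : ∀ k : ℤ, k ≠ 0 → ∀ᶠ n in u, ∀ x : G n, ∃ y, k • y = x)
    (k : ℤ) (hk : k ≠ 0) (a : ReducedProduct u G) : ∃ b, k • b = a := by
  classical
  obtain ⟨x, rfl⟩ := QuotientAddGroup.mk_surjective a
  refine ⟨QuotientAddGroup.mk fun n => if h : ∃ y, k • y = x n then h.choose else 0, ?_⟩
  rw [← QuotientAddGroup.mk_zsmul, ReducedProduct.mk_eq_mk]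
  filter_upwards [h k hk] with n hn
  simp only [Pi.smul_apply, dif_pos (hn (x n))]
  exact (hn (x n)).choose_spec

theorem eventually_dvd_factorial (hu : u ≤ atTop) (k : ℤ) (hk : k ≠ 0) :
    ∀ᶠ n in u, k ∣ (n.factorial : ℤ) := by
  filter_upwards [hu (eventually_ge_atTop k.natAbs)] with n hn
  rw [← Int.natAbs_dvd]
  exact Int.natCast_dvd_natCast.2 (Nat.dvd_factorial (Int.natAbs_pos.2 hk) hn)

theorem mk_factorial_smul_mem_divisiblePart (hu : u ≤ atTop) (x : ∀ n, G n) :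
    (QuotientAddGroup.mk fun n => n.factorial • x n) ∈ divisiblePart (ReducedProduct u G) := by
  intro k hk
  refine ⟨QuotientAddGroup.mk fun n => ((n.factorial : ℤ) / k) • x n, ?_⟩
  rw [← QuotientAddGroup.mk_zsmul, ReducedProduct.mk_eq_mk]
  filter_upwards [eventually_dvd_factorial hu k hk] with n hn
  rw [Pi.smul_apply, ← mul_smul, Int.mul_ediv_cancel' hn, natCast_zsmul]

/-- The factor added to `ℚ⁺` in the `n`-th approximation: its torsion is prime to `1, …, n`. -/
abbrev TorsionPart (n : ℕ) : Type := ZMod (n.factorial + 1)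

theorem eventually_exists_mul_eq_one (hu : u ≤ atTop) (k : ℤ) (hk : k ≠ 0) :
    ∀ᶠ n in u, ∃ c : TorsionPart n, (k : TorsionPart n) * c = 1 := by
  filter_upwards [eventually_dvd_factorial hu k hk] with n ⟨c, hc⟩
  -- From `n! = k * c` and `n! = -1` in `ZMod (n! + 1)`.
  refine ⟨-c, ?_⟩
  have h : (((n.factorial + 1 : ℕ) : ℤ) : TorsionPart n) = 0 := by
    rw [Int.cast_natCast, ZMod.natCast_self]
  push_cast [hc] at h
  linear_combination -h

theorem isAddTorsionFree_torsionPart (hu : u ≤ atTop) :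
    IsAddTorsionFree (ReducedProduct u TorsionPart) := by
  refine ReducedProduct.isAddTorsionFree fun k hk => ?_
  filter_upwards [eventually_exists_mul_eq_one hu k (by exact_mod_cast hk)] with n ⟨c, hc⟩ x hx
  rw [nsmul_eq_mul] at hx
  push_cast at hc
  linear_combination c * hx - x * hc

theorem exists_zsmul_eq_torsionPart (hu : u ≤ atTop) (k : ℤ) (hk : k ≠ 0)
    (a : ReducedProduct u TorsionPart) : ∃ b, k • b = a := by
  refine ReducedProduct.exists_zsmul_eq (fun k hk => ?_) k hk a
  filter_upwards [eventually_exists_mul_eq_one hu k hk] with n ⟨c, hc⟩ x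
  exact ⟨c * x, by rw [zsmul_eq_mul, ← mul_assoc, hc, one_mul]⟩

/-- The `q`-adic valuation on the positive rationals. -/
def posRatVal (q : Nat.Primes) : Additive PosRat →+ ℤ where
  toFun x := padicValRat q x.toMul.1
  map_zero' := padicValRat.one
  map_add' x y := by
    have : Fact (q : ℕ).Prime := ⟨q.2⟩
    exact padicValRat.mul x.toMul.2.ne' y.toMul.2.ne'

/-- A prime number as a positive rational. -/
def primePosRat (q : Nat.Primes) : Additive PosRat :=
  Additive.ofMul ⟨((q : ℕ) : ℚ), by exact_mod_cast q.2.pos⟩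

/-- The `q`-adic valuations form a dual family. -/
theorem linearIndependent_primePosRat : LinearIndependent ℤ primePosRat := by
  refine LinearIndependent.of_pairwise_dual_eq_zero_one _
    (fun q => (posRatVal q).toIntLinearMap) (fun i j hij => ?_) fun i => ?_
  · have : Fact (i : ℕ).Prime := ⟨i.2⟩
    have : Fact (j : ℕ).Prime := ⟨j.2⟩
    change padicValRat i ((j : ℕ) : ℚ) = 0
    rw [padicValRat.of_nat, padicValNat_primes fun h => hij (Subtype.ext h), Nat.cast_zero]
  · have : Fact (i : ℕ).Prime := ⟨i.2⟩
    change padicValRat i ((i : ℕ) : ℚ) = 1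
    rw [padicValRat.of_nat, padicValNat_self, Nat.cast_one]

/-- The map `a ↦ (n! • a)ₙ`. -/
def factorialMul (u : Filter ℕ) : Additive PosRat →+ ReducedProduct u fun _ => Additive PosRat :=
  (QuotientAddGroup.mk' _).comp (AddMonoidHom.pi fun n => nsmulAddMonoidHom n.factorial)

theorem factorialMul_injective [u.NeBot] : Function.Injective (factorialMul u) := by
  rw [injective_iff_map_eq_zero]
  intro a ha
  obtain ⟨n, hn⟩ := (ReducedProduct.mk_eq_zero.1 ha).exists
  exact (nsmul_eq_zero_iff_right n.factorial_ne_zero).1 hn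

theorem nonempty_reducedProduct_prod_addEquiv [u.NeBot] (hu : u ≤ atTop) :
    Nonempty ((ReducedProduct u fun _ => Additive PosRat) × ReducedProduct u TorsionPart ≃+
      ReducedProduct u fun _ => Additive PosRat) := by
  have : IsAddTorsionFree (ReducedProduct u TorsionPart) := isAddTorsionFree_torsionPart hu
  have : IsAddTorsionFree (ReducedProduct u fun _ => Additive PosRat) :=
    ReducedProduct.isAddTorsionFree fun k hk => Eventually.of_forall fun n x hx =>
      (nsmul_eq_zero_iff_right hk).1 hx
  refine nonempty_prod_addEquiv_of_divisible (exists_zsmul_eq_torsionPart hu)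
    (fun q => factorialMul u (primePosRat q)) ?_
    (fun q => mk_factorial_smul_mem_divisiblePart hu fun _ => primePosRat q)
    -- Residues become positive rationals after adding 1; the factor `n!` lands in the divisible
    -- part and loses nothing, as `ℚ⁺` is torsion-free.
    (fun v => QuotientAddGroup.mk fun n => n.factorial •
      (Additive.ofMul ⟨((v.out n).val : ℚ) + 1, by positivity⟩ : Additive PosRat)) ?_
    fun v => mk_factorial_smul_mem_divisiblePart hu _
  · let φ : Additive PosRat →ₗ[ℤ] ReducedProduct u fun _ => Additive PosRat :=
      (factorialMul u).toIntLinearMap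
    have hφ : Function.Injective φ := factorialMul_injective
    exact linearIndependent_primePosRat.map_injOn φ hφ.injOn
  · intro v w h
    rw [ReducedProduct.mk_eq_mk] at h
    rw [← QuotientAddGroup.out_eq' v, ← QuotientAddGroup.out_eq' w, ReducedProduct.mk_eq_mk]
    filter_upwards [h] with n hn
    have h₁ := congrArg Subtype.val (Additive.ofMul.injective
      (nsmul_right_injective n.factorial_ne_zero hn))
    apply ZMod.val_injective
    exact_mod_cast add_right_cancel h₁

end ReducedProduct

/-! ### Ultraproducts and finite axiomatizability -/

section ModelTheory

open Filter

variable {L : FirstOrder.Language.{0, 0}}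

theorem not_finitelyAxiomatizable_of_ultraproduct {A : Type} [L.Structure A] [Nonempty A]
    (M : ℕ → Type) [∀ n, L.Structure (M n)] [∀ n, Nonempty (M n)] (u : Ultrafilter ℕ)
    (hM : ∀ n, ¬ (A ≅[L] M n))
    (e : Nonempty ((u : Filter ℕ).Product (fun _ => A) ≃[L] (u : Filter ℕ).Product M)) :
    ¬ FinitelyAxiomatizable (L.completeTheory A) := by
  rintro ⟨S, hS, h⟩
  obtain ⟨e⟩ := e
  have hev : ∀ φ ∈ S, ∀ᶠ n in u, M n ⊨ φ := by
    intro φ hφ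
    have hA : A ⊨ φ := ((h φ).1 (Theory.models_sentence_of_mem hφ)).realize_sentence A
    rw [← Ultraproduct.sentence_realize, ← StrongHomClass.realize_sentence e,
      Ultraproduct.sentence_realize]
    exact Eventually.of_forall fun _ => hA
  obtain ⟨n, hn⟩ := ((eventually_all_finite hS).2 hev).exists
  have : M n ⊨ S := ⟨hn⟩
  have : M n ⊨ L.completeTheory A :=
    ⟨fun φ hφ => ((h φ).2 (Theory.models_sentence_of_mem hφ)).realize_sentence (M n)⟩
  exact hM n (elementarilyEquivalent_iff.2 fun φ =>
    (L.realize_iff_of_model_completeTheory A (M n) φ).symm)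

/-- An interpretation of an algebraic language in all groups, natural in homomorphisms, in which
multiplication is the value of a function symbol. -/
structure GroupInterpretation (L : FirstOrder.Language.{0, 0}) where
  /-- The structure carried by a group. -/
  str : ∀ (G : Type) [Group G], L.Structure G
  isAlgebraic : L.IsAlgebraic
  map_funMap : ∀ {G H : Type} [Group G] [Group H] (φ : G →* H) {n : ℕ} (f : L.Functions n)
    (v : Fin n → G), φ ((str G).funMap f v) = (str H).funMap f (φ ∘ v)
  /-- The symbol for multiplication. -/
  mul : L.Functions 2
  funMap_mul : ∀ {G : Type} [Group G] (v : Fin 2 → G), (str G).funMap mul v = v 0 * v 1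

namespace GroupInterpretation

variable (I : GroupInterpretation L)

/-- The term `t ^ (n + 1)`. -/
def powSucc {α : Type} (t : L.Term α) : ℕ → L.Term α
  | 0 => t
  | n + 1 => Functions.apply₂ I.mul (powSucc t n) t

theorem realize_powSucc {G : Type} [Group G] {α : Type} (v : α → G) (t : L.Term α) (n : ℕ) :
    letI := I.str G
    (I.powSucc t n).realize v = t.realize v ^ (n + 1) := by
  let _ := I.str G
  induction n with
  | zero => simp [powSucc]
  | succ n ih =>
    rw [powSucc, Term.realize_functions_apply₂, I.funMap_mul, pow_succ _ (n + 1), ← ih]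
    rfl

/-- `∀ x y, x ^ (n + 1) = y ^ (n + 1) → x = y`. -/
def powInjective (n : ℕ) : L.Sentence :=
  ∀' ∀' ((I.powSucc (&0) n =' I.powSucc (&1) n) ⟹ (&0 =' &1))

/-- Injectivity of powers expresses torsion-freeness without the constant `1`, so it serves both
languages. -/
theorem realize_powInjective {G : Type} [Group G] (n : ℕ) :
    letI := I.str G
    G ⊨ I.powInjective n ↔ ∀ x y : G, x ^ (n + 1) = y ^ (n + 1) → x = y := by
  let _ := I.str G
  simp [Sentence.Realize, Formula.Realize, powInjective, realize_powSucc, Fin.snoc]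

/-- Two ultraproducts of groups are isomorphic if both products map onto the same group, the kernels
being the sequences that are trivial along the ultrafilter. -/
theorem nonempty_ultraproduct_equiv (M N : ℕ → Type) [∀ n, Group (M n)] [∀ n, Group (N n)]
    {Q : Type} [Group Q] (u : Ultrafilter ℕ) (q : (∀ n, M n) →* Q) (r : (∀ n, N n) →* Q)
    (hq : Function.Surjective q) (hr : Function.Surjective r)
    (hq' : ∀ x, q x = 1 ↔ ∀ᶠ n in u, x n = 1) (hr' : ∀ x, r x = 1 ↔ ∀ᶠ n in u, x n = 1) :
    letI := fun n => I.str (M n)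
    letI := fun n => I.str (N n)
    Nonempty ((u : Filter ℕ).Product M ≃[L] (u : Filter ℕ).Product N) := by
  let _ := I.str Q
  let _ := fun n => I.str (M n)
  let _ := fun n => I.str (N n)
  have key : ∀ (M : ℕ → Type) [∀ n, Group (M n)] (q : (∀ n, M n) →* Q),
      Function.Surjective q → (∀ x, q x = 1 ↔ ∀ᶠ n in u, x n = 1) →
      letI := fun n => I.str (M n)
      Nonempty ((u : Filter ℕ).Product M ≃[L] Q) := by
    intro M _ q hq hq'
    let _ := fun n => I.str (M n)
    have hqe : ∀ x y : ∀ n, M n, q x = q y ↔ ∀ᶠ n in u, x n = y n := by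
      intro x y
      rw [← div_eq_one, ← map_div, hq']
      simp [div_eq_one]
    let e : (u : Filter ℕ).Product M → Q := Quotient.lift q fun x y h => (hqe x y).2 h
    have he : Function.Bijective e := by
      refine ⟨fun a b => ?_, fun z => ?_⟩
      · refine Quotient.inductionOn₂ a b fun x y h => Quotient.sound ((hqe x y).1 h)
      · obtain ⟨x, rfl⟩ := hq z
        exact ⟨Quotient.mk _ x, rfl⟩
    refine ⟨⟨Equiv.ofBijective e he, fun {k} f x => ?_, fun {k} R => (I.isAlgebraic k).elim R⟩⟩
    obtain ⟨y, rfl⟩ : ∃ y : Fin k → ∀ n, M n, x = fun i => Quotient.mk _ (y i) :=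
      ⟨fun i => (x i).out, funext fun i => (Quotient.out_eq _).symm⟩
    have h₁ := Ultraproduct.funMap_cast (u := u) f y
    refine (congrArg e h₁).trans ?_
    change q (fun a => Structure.funMap f fun i => y i a) = Structure.funMap f (q ∘ y)
    rw [← I.map_funMap q f y]
    congr 1
    funext a
    exact (I.map_funMap (Pi.evalMonoidHom M a) f y).symm
  obtain ⟨e⟩ := key M q hq hq'
  obtain ⟨e'⟩ := key N r hr hr'
  exact ⟨e'.symm.comp e⟩

/-- The groups `ℚ⁺ × ℤ/(n! + 1)`, which approximate `ℚ⁺`. -/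
abbrev Approximant (n : ℕ) : Type := PosRat × Multiplicative (TorsionPart n)

theorem not_elementarilyEquivalent_approximant (n : ℕ) :
    letI := I.str PosRat
    letI := I.str (Approximant n)
    ¬ (PosRat ≅[L] Approximant n) := by
  let _ := I.str PosRat
  let _ := I.str (Approximant n)
  intro h
  -- The exponent here is `n! + 1`, which kills the cyclic factor.
  have h₁ : PosRat ⊨ I.powInjective n.factorial :=
    (I.realize_powInjective _).2 fun x y hxy => pow_left_injective (Nat.succ_ne_zero _) hxy
  have h₂ := (I.realize_powInjective _).1 ((elementarilyEquivalent_iff.1 h _).1 h₁)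
    (1, Multiplicative.ofAdd 1) 1 ?_
  · have h₃ : (1 : TorsionPart n) = 0 := congrArg (fun z => Multiplicative.toAdd (Prod.snd z)) h₂
    rw [← Nat.cast_one, ZMod.natCast_eq_zero_iff] at h₃
    have := n.factorial_pos
    have := Nat.le_of_dvd one_pos h₃
    omega
  · rw [one_pow, Prod.pow_mk, one_pow, ← ofAdd_nsmul, nsmul_one, ZMod.natCast_self, ofAdd_zero]
    rfl

theorem nonempty_ultraproduct_approximant_equiv (u : Ultrafilter ℕ) (hu : (u : Filter ℕ) ≤ atTop) :
    letI := I.str PosRat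
    letI := fun n => I.str (Approximant n)
    Nonempty ((u : Filter ℕ).Product (fun _ => PosRat) ≃[L] (u : Filter ℕ).Product Approximant) := by
  obtain ⟨e⟩ := nonempty_reducedProduct_prod_addEquiv (u := (u : Filter ℕ)) hu
  let s (x : ∀ n, Approximant n) : (ReducedProduct u fun _ => Additive PosRat) ×
      ReducedProduct u TorsionPart :=
    (QuotientAddGroup.mk fun n => .ofMul (x n).1, QuotientAddGroup.mk fun n => (x n).2.toAdd)
  refine I.nonempty_ultraproduct_equiv (fun _ => PosRat) Approximant u
    (Q := Multiplicative (ReducedProduct u fun _ => Additive PosRat))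
    ⟨⟨fun x => .ofAdd (QuotientAddGroup.mk fun n => .ofMul (x n)), rfl⟩, fun _ _ => rfl⟩
    ⟨⟨fun x => .ofAdd (e (s x)), congrArg _ (map_zero e)⟩,
      fun x y => map_add e (s x) (s y)⟩ ?_ ?_ ?_ ?_
  · intro z
    obtain ⟨x, hx⟩ := QuotientAddGroup.mk_surjective z.toAdd
    exact ⟨fun n => (x n).toMul, hx⟩
  · intro z
    obtain ⟨⟨a, b⟩, hab⟩ := e.surjective z.toAdd
    obtain ⟨x, rfl⟩ := QuotientAddGroup.mk_surjective a
    obtain ⟨y, rfl⟩ := QuotientAddGroup.mk_surjective b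
    exact ⟨fun n => ((x n).toMul, .ofAdd (y n)), hab⟩
  · exact fun x => ReducedProduct.mk_eq_zero
  · intro x
    refine (map_eq_zero_iff e e.injective (x := s x)).trans ?_
    rw [Prod.mk_eq_zero, ReducedProduct.mk_eq_zero, ReducedProduct.mk_eq_zero, ← eventually_and]
    refine eventually_congr (Eventually.of_forall fun n => ?_)
    exact (Prod.ext_iff (x := x n) (y := 1)).symm

theorem not_finitelyAxiomatizable :
    letI := I.str PosRat
    ¬ FinitelyAxiomatizable (L.completeTheory PosRat) :=
  letI := I.str PosRat
  letI := fun n => I.str (Approximant n)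
  not_finitelyAxiomatizable_of_ultraproduct Approximant (hyperfilter ℕ)
    I.not_elementarilyEquivalent_approximant
    (I.nonempty_ultraproduct_approximant_equiv _ Nat.hyperfilter_le_atTop)

end GroupInterpretation

/-- Groups as `{×}`-structures. -/
def mulInterpretation : GroupInterpretation mulLang where
  str G _ := mulStructure G
  isAlgebraic _ := inferInstanceAs (IsEmpty Empty)
  map_funMap φ _ f v := by cases f; exact map_mul φ _ _
  mul := MulFunc.mul
  funMap_mul _ := rfl

/-- Groups as `{×, 1, ⁻¹}`-structures. -/
def groupInterpretation : GroupInterpretation groupLang where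
  str G _ := groupStructure G
  isAlgebraic _ := inferInstanceAs (IsEmpty Empty)
  map_funMap φ _ f v := by
    cases f
    · exact map_mul φ _ _
    · exact map_one φ
    · exact map_inv φ _
  mul := GroupFunc.mul
  funMap_mul _ := rfl

end ModelTheory

/-! ### The groups `G_p` -/

section TwistedGroup

theorem isPrimitiveRoot_omega {p : ℕ} (hp : p ≠ 0) : IsPrimitiveRoot (omega p) p := by
  have h := Complex.isPrimitiveRoot_exp p hp
  rwa [show 2 * (Real.pi : ℂ) * Complex.I / p = 2 * Real.pi / p * Complex.I by ring,
    Complex.exp_mul_I] at h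

variable {p : ℕ}

theorem norm_omega (hp : p ≠ 0) : ‖omega p‖ = 1 := (isPrimitiveRoot_omega hp).norm'_eq_one hp

theorem exists_pos_norm_eq (hp : p ≠ 0) (z : twistedGroup p) :
    ∃ r : ℚ, 0 < r ∧ ‖((z : ℂˣ) : ℂ)‖ = r := by
  obtain ⟨r, k, hr, h⟩ := z.2
  refine ⟨r, hr, ?_⟩
  rw [h, norm_mul, norm_pow, norm_omega hp, one_pow, mul_one]
  have : (0 : ℝ) < r := by exact_mod_cast hr
  simp [abs_of_pos this]

/-- The product of a positive rational with a power of `ω_p`, as an element of `G_p`. -/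
noncomputable def twistedMk (hp : p ≠ 0) (r : ℚ) (hr : 0 < r) (k : ℕ) : twistedGroup p :=
  ⟨Units.mk0 ((r : ℂ) * omega p ^ k)
    (mul_ne_zero (by exact_mod_cast hr.ne') (pow_ne_zero _ ((isPrimitiveRoot_omega hp).ne_zero hp))),
    r, k, hr, rfl⟩

theorem realize_tpow {α : Type} (v : α → twistedGroup p) (t : groupLang.Term α) (n : ℕ) :
    (tpow t n).realize v = t.realize v ^ n := by
  induction n with
  | zero => rfl
  | succ n ih =>
    rw [pow_succ, ← ih]
    rfl

theorem realize_tmul {α : Type} (v : α → twistedGroup p) (s t : groupLang.Term α) :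
    (tmul s t).realize v = s.realize v * t.realize v := rfl

theorem realize_tinv {α : Type} (v : α → twistedGroup p) (t : groupLang.Term α) :
    (tinv t).realize v = (t.realize v)⁻¹ := rfl

theorem realize_tone {α : Type} (v : α → twistedGroup p) :
    (tone : groupLang.Term α).realize v = 1 := rfl

theorem realize_axTorsionFree (n : ℕ) :
    twistedGroup p ⊨ axTorsionFree n ↔ ∀ x : twistedGroup p, x ^ n = 1 → x = 1 := by
  simp [Sentence.Realize, Formula.Realize, axTorsionFree, realize_tpow, realize_tone, Fin.snoc]

theorem realize_axNonPower (n ℓ : ℕ) (m : Fin ℓ → ℕ) :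
    twistedGroup p ⊨ axNonPower n ℓ m ↔ ∀ v : Fin ℓ → twistedGroup p,
      ∃ x, ∀ z, ∀ k, x ^ n * v k ≠ z ^ m k := by
  refine BoundedFormula.realize_alls.trans (forall_congr' fun v => ?_)
  simp only [BoundedFormula.realize_ex, BoundedFormula.realize_all, BoundedFormula.realize_iInf,
    BoundedFormula.realize_not, BoundedFormula.realize_bdEqual, realize_tmul, realize_tpow,
    Term.realize_var, Sum.elim_inr, Fin.snoc_castSucc, Fin.snoc_last, ne_eq]

/-- Taking norms, a torsion element has `r = 1`; then `ω_p ^ (k * n) = 1` gives `p ∣ k` or `p ∣ n`.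
-/
theorem realize_axTorsionFree_iff (hp : p.Prime) (n : ℕ) (hn : 1 ≤ n) :
    twistedGroup p ⊨ axTorsionFree n ↔ ¬ p ∣ n := by
  have hω := isPrimitiveRoot_omega hp.ne_zero
  rw [realize_axTorsionFree]
  constructor
  · intro h hpn
    have h₁ := h (twistedMk hp.ne_zero 1 one_pos 1) <| Subtype.ext <| Units.ext <| by
      simpa [twistedMk] using (hω.pow_eq_one_iff_dvd n).2 hpn
    have h₂ : omega p = 1 := by
      simpa [twistedMk] using congrArg (fun z : twistedGroup p => ((z : ℂˣ) : ℂ)) h₁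
    exact hω.ne_one hp.one_lt h₂
  · intro hpn x hx
    have hx' : ((x : ℂˣ) : ℂ) ^ n = 1 := by
      simpa using congrArg (fun z : twistedGroup p => ((z : ℂˣ) : ℂ)) hx
    obtain ⟨r, k, hr, h⟩ := x.2
    have hr' : (0 : ℝ) < r := by exact_mod_cast hr
    have hr₁ : (r : ℝ) = 1 := by
      have h₁ := congrArg norm hx'
      rw [h, norm_pow, norm_mul, norm_pow, norm_omega hp.ne_zero, one_pow, mul_one, norm_one,
        Complex.norm_ratCast, abs_of_pos hr'] at h₁
      exact (pow_eq_one_iff_of_nonneg hr'.le (by omega)).1 h₁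
    have hr₂ : r = 1 := by exact_mod_cast hr₁
    rw [hr₂, Rat.cast_one, one_mul] at h
    rw [h, ← pow_mul, hω.pow_eq_one_iff_dvd, hp.dvd_mul] at hx'
    apply Subtype.ext
    apply Units.ext
    rw [h]
    exact (hω.pow_eq_one_iff_dvd k).2 (hx'.resolve_right hpn)

theorem exists_prime_padicValRat_eq_zero {ℓ : ℕ} (r : Fin ℓ → ℚ) (hr : ∀ k, 0 < r k) :
    ∃ q : ℕ, q.Prime ∧ ∀ k, padicValRat q (r k) = 0 := by
  -- A prime exceeding every numerator and denominator divides none of them.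
  obtain ⟨q, hq, hqp⟩ := Nat.exists_infinite_primes
    (∑ k, ((r k).num.natAbs + (r k).den) + 1)
  refine ⟨q, hqp, fun k => ?_⟩
  have hk := Finset.single_le_sum (f := fun k => (r k).num.natAbs + (r k).den)
    (fun _ _ => Nat.zero_le _) (Finset.mem_univ k)
  have hnum : ¬ q ∣ (r k).num.natAbs := fun h => by
    have := Nat.le_of_dvd (Int.natAbs_pos.2 (Rat.num_pos.2 (hr k)).ne') h
    omega
  have hden : ¬ q ∣ (r k).den := fun h => by
    have := Nat.le_of_dvd (r k).den_pos h
    omega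
  rw [padicValRat_def, padicValInt, padicValNat.eq_zero_of_not_dvd hnum,
    padicValNat.eq_zero_of_not_dvd hden, sub_self]

theorem realize_axNonPower_of_not_dvd (hp : p ≠ 0) (n ℓ : ℕ) (m : Fin ℓ → ℕ)
    (hm : ∀ k, ¬ m k ∣ n) : twistedGroup p ⊨ axNonPower n ℓ m := by
  rw [realize_axNonPower]
  intro v
  choose r hr hv using fun k => exists_pos_norm_eq hp (v k)
  obtain ⟨q, hq, hqr⟩ := exists_prime_padicValRat_eq_zero r hr
  have : Fact q.Prime := ⟨hq⟩
  have hq0 : (0 : ℚ) < q := by exact_mod_cast hq.pos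
  -- With `x = q`, the norm of `x ^ n * v k` has `q`-adic valuation `n`, whereas that of `z ^ m k`
  -- is a multiple of `m k`.
  refine ⟨twistedMk hp q hq0 0, fun z k h => hm k ?_⟩
  obtain ⟨s, hs, hz⟩ := exists_pos_norm_eq hp z
  have h₁ := congrArg (fun z : twistedGroup p => ‖((z : ℂˣ) : ℂ)‖) h
  simp only [Subgroup.coe_mul, Subgroup.coe_pow, Units.val_mul, Units.val_pow_eq_pow_val, norm_mul,
    norm_pow, hv, hz, twistedMk, Units.val_mk0, pow_zero, mul_one, Rat.cast_natCast,
    Complex.norm_natCast] at h₁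
  have h₂ : (q : ℚ) ^ n * r k = s ^ m k := by exact_mod_cast h₁
  have h₃ := congrArg (padicValRat q) h₂
  rw [padicValRat.mul (pow_ne_zero _ hq0.ne') (hr k).ne', hqr, padicValRat.pow,
    padicValRat.pow, padicValRat.self hq.one_lt, mul_one, add_zero] at h₃
  exact Int.natCast_dvd_natCast.1 ⟨_, h₃⟩

theorem twistedGroup_models_coreAxioms (hp : p ≠ 0) : twistedGroup p ⊨ coreAxioms := by
  refine ⟨?_⟩
  rintro φ ((rfl | rfl | rfl | rfl) | ⟨n, ℓ, m, -, hm, rfl⟩)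
  · simp [Sentence.Realize, Formula.Realize, axAssoc, realize_tmul, mul_assoc]
  · simp [Sentence.Realize, Formula.Realize, axOne, realize_tmul, realize_tone]
  · simp [Sentence.Realize, Formula.Realize, axInv, realize_tmul, realize_tone, realize_tinv]
  · simp [Sentence.Realize, Formula.Realize, axComm, realize_tmul, mul_comm]
  · exact realize_axNonPower_of_not_dvd hp n ℓ m hm

end TwistedGroup

end PosRatMul

theorem theorem4p12 :
    ¬ PosRatMul.FinitelyAxiomatizable
        (PosRatMul.mulLang.completeTheory PosRatMul.PosRat) ∧
    ¬ PosRatMul.FinitelyAxiomatizable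
        (PosRatMul.groupLang.completeTheory PosRatMul.PosRat) ∧
    ∀ p : ℕ, p.Prime →
      PosRatMul.twistedGroup p ⊨ PosRatMul.coreAxioms ∧
      ∀ n : ℕ, 1 ≤ n →
        (PosRatMul.twistedGroup p ⊨ PosRatMul.axTorsionFree n ↔ ¬ p ∣ n) :=
  ⟨PosRatMul.mulInterpretation.not_finitelyAxiomatizable,
    PosRatMul.groupInterpretation.not_finitelyAxiomatizable,
    fun _ hp => ⟨PosRatMul.twistedGroup_models_coreAxioms hp.ne_zero,
      PosRatMul.realize_axTorsionFree_iff hp⟩⟩
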